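/- Let $\Omega\subset\mathbb{R}^d$ be open, let $V_h\subset H^1(\Omega;\mathbb{R}^d)$ and $Q_h\subset L^2(\Omega)$ be finite-dimensional (for instance $V_h$ may consist of fields vanishing on a part $\Gamma_D$ of the boundary), and let $\Pi_{Q_h}$ be the $L^2$-orthogonal projection onto $Q_h$. With $\varepsilon(\mathbf u)=\frac12(\nabla\mathbf u+\nabla\mathbf u^\top)$ and $\gamma\ge 0$ put $$a(\mathbf u,\mathbf v)=(\varepsilon(\mathbf u),\varepsilon(\mathbf v))_{L^2},\qquad c_h(\mathbf u,\mathbf v)=(\Pi_{Q_h}(\nabla\cdot\mathbf u),\Pi_{Q_h}(\nabla\cdot\mathbf v))_{L^2},$$ $$A_{h,\gamma}:V_h\to V_h^*,\qquad \langle A_{h,\gamma}\mathbf u,\mathbf v\rangle=a(\mathbf u,\mathbf v)+\gamma\, c_h(\mathbf u,\mathbf v),$$ and $\mathcal N_h=\{\mathbf v\in V_h:\Pi_{Q_h}(\nabla\cdot\mathbf v)=0\}$. Write $\|\cdot\|_0$ and $\|\cdot\|_1$ for the standard $L^2$ and $H^1$ norms. Assume that $V_h\times Q_h$ is inf-sup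 stable for the mixed problem $B((\mathbf u,p),(\mathbf v,q))=a(\mathbf u,\mathbf v)-(\nabla\cdot\mathbf v,p)-(\nabla\cdot\mathbf u,q)$ with constant $\beta>0$, that is, $$\beta\,(\|\mathbf u\|_1+\|p\|_0)\le\sup_{0\ne(\mathbf v,q)\in V_h\times Q_h}\frac{B((\mathbf u,p),(\mathbf v,q))}{\|\mathbf v\|_1+\|q\|_0}\qquad\text{for all }0\neq(\mathbf u,p)\in V_h\times Q_h.$$ Let $V_h=\sum_i V_i$ be a finite space decomposition (not necessarily direct) with overlap $N_O$, meaning that almost every point of $\Omega$ lies in the supports of at most $N_O$ of the subspaces $V_i$ (the support of $V_i$ being the union of the supports of its elements). Assume that there are constants $c_1=c_1(h)>0$ and $c_2=c_2(h)\ge0$ such that for all $\mathbf u_h\in V_h$ and all $\mathbf u_0\in\mathcal N_h$ $$\inf_{\substack{\mathbf u_h=\sum_i\mathbf u_i\\ \mathbf u_i\in V_i}}\sum_i\|\mathbf u_i\|_1^2\le c_1\|\mathbf u_h\|_0^2,\qquad \inf_{\substack{\mathbf u_0=\sum_i\mathbf u_{0,i}\\ \mathbf u_{0,i}\in\mathcal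 N_h\cap V_i}}\sum_i\|\mathbf u_{0,i}\|_1^2\le c_2\|\mathbf u_0\|_0^2,$$ where an infimum over the empty set is $+\infty$. Let $I_i:V_i\to V_h$ be the inclusion, $A_i=I_i^*A_{h,\gamma}I_i$, and let the additive Schwarz preconditioner $D_{h,\gamma}:V_h\to V_h^*$ be defined by $D_{h,\gamma}^{-1}=\sum_i I_iA_i^{-1}I_i^*$. Then every $A_i$ and the operator $\sum_i I_iA_i^{-1}I_i^*$ are invertible, so that $D_{h,\gamma}$ is well defined, and there is a constant $C>0$ depending only on $d$ and $\beta$ (in particular not on $\gamma$, $V_h$, $Q_h$, or the decomposition) such that for all $\gamma\ge0$ and all $\mathbf u\in V_h$ $$(c_1+c_2)^{-1}\langle D_{h,\gamma}\mathbf u,\mathbf u\rangle\le C\,\langle A_{h,\gamma}\mathbf u,\mathbf u\rangle,$$ and, if the pair is exact in the sense that $Q_h=\nabla\cdot V_h$, also $$\langle A_{h,\gamma}\mathbf u,\mathbf u\rangle\le N_O\,\langle D_{h,\gamma}\mathbf u,\mathbf u\rangle .$$ -/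

import Mathlib

open MeasureTheory
open scoped ContDiff ENNReal

noncomputable section

namespace Elasticity

/-! ### Sobolev fields on an open set of `ℝ^d` -/

/-- The scalar Lebesgue space `L²(Ω)`. -/
abbrev L2 {d : ℕ} (Ω : Set (EuclideanSpace ℝ (Fin d))) : Type :=
  Lp ℝ 2 (volume.restrict Ω)

/-- `g` is the weak partial derivative `∂_j f` on `Ω`. -/
def IsWeakPartial {d : ℕ} {Ω : Set (EuclideanSpace ℝ (Fin d))} (j : Fin d) (f g : L2 Ω) : Prop :=
  ∀ φ : EuclideanSpace ℝ (Fin d) → ℝ, ContDiff ℝ ∞ φ → HasCompactSupport φ → tsupport φ ⊆ Ω →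
    ∫ x in Ω, f x * fderiv ℝ φ x (EuclideanSpace.single j 1) = -∫ x in Ω, g x * φ x

theorem integrable_L2_mul {d : ℕ} {Ω : Set (EuclideanSpace ℝ (Fin d))} (f : L2 Ω)
    {ψ : EuclideanSpace ℝ (Fin d) → ℝ} (hψ : Continuous ψ) (hc : HasCompactSupport ψ) :
    Integrable (fun x => f x * ψ x) (volume.restrict Ω) :=
  (Lp.memLp f).integrable_mul
    (q := 2) ((hψ.memLp_of_hasCompactSupport (p := 2) (μ := volume) hc).restrict Ω)

theorem continuous_partial {d : ℕ} {φ : EuclideanSpace ℝ (Fin d) → ℝ} (hφ : ContDiff ℝ ∞ φ)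
    (j : Fin d) : Continuous fun x => fderiv ℝ φ x (EuclideanSpace.single j 1) :=
  (hφ.continuous_fderiv (by simp)).clm_apply continuous_const

theorem compactSupport_partial {d : ℕ} {φ : EuclideanSpace ℝ (Fin d) → ℝ}
    (hc : HasCompactSupport φ) (j : Fin d) :
    HasCompactSupport fun x => fderiv ℝ φ x (EuclideanSpace.single j 1) :=
  hc.fderiv_apply ℝ (EuclideanSpace.single j 1)

theorem IsWeakPartial.zero {d : ℕ} {Ω : Set (EuclideanSpace ℝ (Fin d))} (j : Fin d) :
    IsWeakPartial j (0 : L2 Ω) 0 := by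
  intro φ _ _ _
  have h := Lp.coeFn_zero ℝ 2 (volume.restrict Ω)
  rw [integral_eq_zero_of_ae, integral_eq_zero_of_ae, neg_zero]
  · filter_upwards [h] with x hx
    rw [hx, Pi.zero_apply, zero_mul]
  · filter_upwards [h] with x hx
    rw [hx, Pi.zero_apply, zero_mul]

theorem IsWeakPartial.add {d : ℕ} {Ω : Set (EuclideanSpace ℝ (Fin d))} {j : Fin d}
    {f f' g g' : L2 Ω} (h : IsWeakPartial j f g) (h' : IsWeakPartial j f' g') :
    IsWeakPartial j (f + f') (g + g') := by
  intro φ hφ hc hs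
  have e1 : ∫ x in Ω, (f + f') x * fderiv ℝ φ x (EuclideanSpace.single j 1) =
      ∫ x in Ω, (f x * fderiv ℝ φ x (EuclideanSpace.single j 1) +
        f' x * fderiv ℝ φ x (EuclideanSpace.single j 1)) := by
    refine integral_congr_ae ?_
    filter_upwards [Lp.coeFn_add f f'] with x hx
    rw [hx, Pi.add_apply, add_mul]
  have e2 : ∫ x in Ω, (g + g') x * φ x = ∫ x in Ω, (g x * φ x + g' x * φ x) := by
    refine integral_congr_ae ?_
    filter_upwards [Lp.coeFn_add g g'] with x hx
    rw [hx, Pi.add_apply, add_mul]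
  rw [e1, e2, integral_add, integral_add, h φ hφ hc hs, h' φ hφ hc hs, neg_add]
  · exact integrable_L2_mul _ hφ.continuous hc
  · exact integrable_L2_mul _ hφ.continuous hc
  · exact integrable_L2_mul _ (continuous_partial hφ j) (compactSupport_partial hc j)
  · exact integrable_L2_mul _ (continuous_partial hφ j) (compactSupport_partial hc j)

theorem IsWeakPartial.smul {d : ℕ} {Ω : Set (EuclideanSpace ℝ (Fin d))} {j : Fin d}
    {f g : L2 Ω} (c : ℝ) (h : IsWeakPartial j f g) : IsWeakPartial j (c • f) (c • g) := by
  intro φ hφ hc hs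
  have e1 : ∫ x in Ω, (c • f) x * fderiv ℝ φ x (EuclideanSpace.single j 1) =
      ∫ x in Ω, c * (f x * fderiv ℝ φ x (EuclideanSpace.single j 1)) := by
    refine integral_congr_ae ?_
    filter_upwards [Lp.coeFn_smul c f] with x hx
    rw [hx, Pi.smul_apply, smul_eq_mul, mul_assoc]
  have e2 : ∫ x in Ω, (c • g) x * φ x = ∫ x in Ω, c * (g x * φ x) := by
    refine integral_congr_ae ?_
    filter_upwards [Lp.coeFn_smul c g] with x hx
    rw [hx, Pi.smul_apply, smul_eq_mul, mul_assoc]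
  rw [e1, e2, integral_const_mul, integral_const_mul, h φ hφ hc hs, mul_neg]

/-- The Sobolev space `H¹(Ω; ℝ^d)` of vector fields, as the space of pairs `(u, ∇u)` where
`u ∈ L²(Ω)^d` and `∇u ∈ L²(Ω)^{d×d}` is the weak gradient, `(∇u) i j = ∂_j u_i`.
For open `Ω` the second component is determined by the first. -/
def H1 {d : ℕ} (Ω : Set (EuclideanSpace ℝ (Fin d))) :
    Submodule ℝ ((Fin d → L2 Ω) × (Fin d → Fin d → L2 Ω)) where
  carrier := {u | ∀ i j, IsWeakPartial j (u.1 i) (u.2 i j)}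
  zero_mem' _ j := IsWeakPartial.zero j
  add_mem' hu hv i j := (hu i j).add (hv i j)
  smul_mem' c _ hu i j := (hu i j).smul c

section Domain

variable {d : ℕ} {Ω : Set (EuclideanSpace ℝ (Fin d))}

/-- The component `u_i` of the field `u`. -/
def comp (i : Fin d) : H1 Ω →ₗ[ℝ] L2 Ω :=
  LinearMap.proj i ∘ₗ LinearMap.fst ℝ _ _ ∘ₗ (H1 Ω).subtype

/-- The weak partial derivative `∂_j u_i`. -/
def grad (i j : Fin d) : H1 Ω →ₗ[ℝ] L2 Ω :=
  LinearMap.proj j ∘ₗ LinearMap.proj i ∘ₗ LinearMap.snd ℝ _ _ ∘ₗ (H1 Ω).subtype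

/-- The symmetric gradient `ε(u) = (∇u + ∇uᵀ) / 2`, entry `(i, j)`. -/
def symGrad (i j : Fin d) : H1 Ω →ₗ[ℝ] L2 Ω := (1 / 2 : ℝ) • (grad i j + grad j i)

/-- The divergence `∇ · u`. -/
def div : H1 Ω →ₗ[ℝ] L2 Ω := ∑ i, grad i i

/-- The norm `‖u‖₀` of `L²(Ω; ℝ^d)`. -/
def norm0 (u : H1 Ω) : ℝ := √(∑ i, ‖comp i u‖ ^ 2)

/-- The norm `‖u‖₁` of `H¹(Ω; ℝ^d)`. -/
def norm1 (u : H1 Ω) : ℝ := √(∑ i, ‖comp i u‖ ^ 2 + ∑ i, ∑ j, ‖grad i j u‖ ^ 2)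

/-! ### The bilinear forms -/

/-- `a(u, v) = (ε(u), ε(v))`. -/
def aForm : H1 Ω →ₗ[ℝ] H1 Ω →ₗ[ℝ] ℝ :=
  ∑ i, ∑ j, (innerₗ (L2 Ω)).compl₁₂ (symGrad i j) (symGrad i j)

/-- The discrete divergence `Π_{Q_h} (∇ · u)`, with `Π_{Q_h}` the `L²`-orthogonal projection. -/
def discreteDiv (Qh : Submodule ℝ (L2 Ω)) [FiniteDimensional ℝ Qh] : H1 Ω →ₗ[ℝ] L2 Ω :=
  (Qh.starProjection : L2 Ω →ₗ[ℝ] L2 Ω) ∘ₗ div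

/-- `c_h(u, v) = (Π_{Q_h} (∇ · u), Π_{Q_h} (∇ · v))`. -/
def cForm (Qh : Submodule ℝ (L2 Ω)) [FiniteDimensional ℝ Qh] : H1 Ω →ₗ[ℝ] H1 Ω →ₗ[ℝ] ℝ :=
  (innerₗ (L2 Ω)).compl₁₂ (discreteDiv Qh) (discreteDiv Qh)

/-- The form of the mixed problem,
`B((u, p), (v, q)) = a(u, v) - (∇ · v, p) - (∇ · u, q)`. -/
def mixedForm (u : H1 Ω) (p : L2 Ω) (v : H1 Ω) (q : L2 Ω) : ℝ :=
  aForm u v - inner ℝ (div v) p - inner ℝ (div u) q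

/-- `V_h × Q_h` is inf-sup stable for the mixed problem, with constant `β`:
`β ‖(u, p)‖ ≤ sup_{(v, q)} B((u, p), (v, q)) / ‖(v, q)‖` for all `(u, p) ∈ V_h × Q_h`, where
`‖(v, q)‖ = ‖v‖₁ + ‖q‖₀`. (The pair `(v, q) = 0` contributes the value `0 / 0 = 0`, which does
not affect the condition.) -/
def InfSupStable (Vh : Submodule ℝ (H1 Ω)) (Qh : Submodule ℝ (L2 Ω)) (β : ℝ) : Prop :=
  ∀ (u : Vh) (p : Qh), ((β * (norm1 (u : H1 Ω) + ‖p‖) : ℝ) : EReal) ≤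
    ⨆ (v : Vh) (q : Qh), ((mixedForm (u : H1 Ω) p v q / (norm1 (v : H1 Ω) + ‖q‖) : ℝ) : EReal)

/-- The discretely divergence-free fields `N_h = {v ∈ V_h : Π_{Q_h} (∇ · v) = 0}`. -/
def discreteKernel (Vh : Submodule ℝ (H1 Ω)) (Qh : Submodule ℝ (L2 Ω)) [FiniteDimensional ℝ Qh] :
    Submodule ℝ Vh :=
  LinearMap.ker (discreteDiv Qh ∘ₗ Vh.subtype)

/-! ### Supports and overlap -/

/-- The (essential, relatively closed) support of a field: the points of `Ω` without a
neighbourhood on which the field vanishes almost everywhere. -/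
def fieldSupport (v : H1 Ω) : Set (EuclideanSpace ℝ (Fin d)) :=
  {x ∈ Ω | ¬ ∃ U, IsOpen U ∧ x ∈ U ∧ ∀ i, ∀ᵐ y ∂volume.restrict (Ω ∩ U), comp i v y = 0}

/-- The set covered by a subspace: the union of the supports of its fields. -/
def subspaceSupport {Vh : Submodule ℝ (H1 Ω)} (W : Submodule ℝ Vh) :
    Set (EuclideanSpace ℝ (Fin d)) :=
  ⋃ v ∈ W, fieldSupport (v : H1 Ω)

/-- The subspaces `W i` have overlap at most `N`: almost every point of `Ω` lies in the supports
of at most `N` of them. -/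
def OverlapLE {Vh : Submodule ℝ (H1 Ω)} {ι : Type*} (W : ι → Submodule ℝ Vh) (N : ℕ) : Prop :=
  ∀ᵐ x ∂volume.restrict Ω, {i | x ∈ subspaceSupport (W i)}.encard ≤ N

/-- `inf ∑ i, ‖w i‖₁²` over all splittings `u = ∑ i, w i` with `w i ∈ W i`, as an extended
nonnegative real; it is `∞` if there is no such splitting. -/
def splittingEnergy {Vh : Submodule ℝ (H1 Ω)} {ι : Type*} [Fintype ι]
    (W : ι → Submodule ℝ Vh) (u : Vh) : ℝ≥0∞ :=
  ⨅ (w : ι → Vh) (_ : (∀ i, w i ∈ W i) ∧ ∑ i, w i = u),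
    ENNReal.ofReal (∑ i, norm1 (w i : H1 Ω) ^ 2)

end Domain

/-! ### The additive Schwarz preconditioner -/

section Operators

open Classical in
/-- The inverse of a linear map (and `0` if the map is not bijective). -/
def linInverse {M N : Type*} [AddCommMonoid M] [Module ℝ M] [AddCommMonoid N] [Module ℝ N]
    (f : M →ₗ[ℝ] N) : N →ₗ[ℝ] M :=
  if h : Function.Bijective f then (LinearEquiv.ofBijective f h).symm else 0

/-- The restriction `A_i = I_i^* A I_i : V_i → V_i^*` of `A : V → V^*` to a subspace,
`⟨A_i u, v⟩ = ⟨A I_i u, I_i v⟩`. -/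
def localOperator {V : Type*} [AddCommMonoid V] [Module ℝ V] (A : V →ₗ[ℝ] Module.Dual ℝ V)
    (W : Submodule ℝ V) : W →ₗ[ℝ] Module.Dual ℝ W :=
  W.subtype.dualMap ∘ₗ A ∘ₗ W.subtype

/-- `D⁻¹ = ∑ i, I_i A_i⁻¹ I_i^* : V^* → V`. -/
def schwarzInverse {V : Type*} [AddCommMonoid V] [Module ℝ V] (A : V →ₗ[ℝ] Module.Dual ℝ V)
    {ι : Type*} [Fintype ι] (W : ι → Submodule ℝ V) : Module.Dual ℝ V →ₗ[ℝ] V :=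
  ∑ i, (W i).subtype ∘ₗ linInverse (localOperator A (W i)) ∘ₗ (W i).subtype.dualMap

/-- The additive Schwarz preconditioner `D : V → V^*`. -/
def schwarz {V : Type*} [AddCommMonoid V] [Module ℝ V] (A : V →ₗ[ℝ] Module.Dual ℝ V)
    {ι : Type*} [Fintype ι] (W : ι → Submodule ℝ V) : V →ₗ[ℝ] Module.Dual ℝ V :=
  linInverse (schwarzInverse A W)

/-- `A_{h,γ} : V_h → V_h^*`, `⟨A_{h,γ} u, v⟩ = a(u, v) + γ c_h(u, v)`. -/
def operatorA {d : ℕ} {Ω : Set (EuclideanSpace ℝ (Fin d))} (Vh : Submodule ℝ (H1 Ω))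
    (Qh : Submodule ℝ (L2 Ω)) [FiniteDimensional ℝ Qh] (γ : ℝ) : Vh →ₗ[ℝ] Module.Dual ℝ Vh :=
  (aForm + γ • cForm Qh).compl₁₂ Vh.subtype Vh.subtype

end Operators

end Elasticity

end

open Elasticity

/-!
The additive Schwarz energy `⟨D u, u⟩` is the minimum of `∑ i, ⟨A uᵢ, uᵢ⟩` over all splittings
`u = ∑ i, uᵢ` with `uᵢ ∈ V_i`, attained at the local solutions with right-hand side `D u`
(`exists_splitting_schwarz_eq`, `schwarz_le_of_splitting`). The operators are invertible because
`A` is positive definite, which is a discrete Korn inequality: testing the inf-sup condition with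
zero pressure bounds `β ‖u‖₁` by a multiple of `‖ε(u)‖₀` (`InfSupStable.norm1_sq_le`).

For the lower spectral bound it suffices to exhibit one good splitting. The inf-sup condition also
makes the mixed problem uniquely solvable, and solving it yields `v ∈ V_h` with
`Π (∇ · v) = Π (∇ · u)` and `β ‖v‖₁ ≤ ‖Π (∇ · u)‖₀` (`InfSupStable.exists_discreteDiv_eq`). The
remainder `u - v` is discretely divergence-free and is split inside the kernel, where `γ` is not
seen; the factor `γ` produced by splitting `v` is compensated by `γ ‖v‖₁² ≤ β⁻² γ c_h(u, u)`.
This gives the constant `C = (8 d + 4) / β²` (`schwarz_operatorA_le`).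

For the upper bound, exactness removes the projection from `c_h`, so that the energy is the
integral of a local density. Weak gradients vanish almost everywhere off the support of a field
(`ae_grad_eq_zero_of_notMem_fieldSupport`), hence at almost every point at most `N` terms of
`∑ i, ε(uᵢ)` are nonzero, and the pointwise Cauchy–Schwarz inequality costs a factor `N`
(`norm_map_sum_sq_le_of_overlapLE`).
-/

namespace Elasticity

/-! ### The additive Schwarz operator of a symmetric positive definite form -/

section Abstract

variable {V : Type*} [AddCommGroup V] [Module ℝ V]

theorem linInverse_apply_self {M N : Type*} [AddCommMonoid M] [Module ℝ M] [AddCommMonoid N]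
    [Module ℝ N] {f : M →ₗ[ℝ] N} (hf : Function.Bijective f) (x : N) :
    f (linInverse f x) = x := by
  rw [linInverse, dif_pos hf]
  exact (LinearEquiv.ofBijective f hf).apply_symm_apply x

theorem localOperator_bijective [FiniteDimensional ℝ V] {A : V →ₗ[ℝ] Module.Dual ℝ V}
    (hpos : ∀ u, u ≠ 0 → 0 < A u u) (W : Submodule ℝ V) :
    Function.Bijective (localOperator A W) := by
  have hinj : Function.Injective (localOperator A W) := by
    refine (injective_iff_map_eq_zero _).2 fun w hw => ?_
    by_contra hne
    have h : A (w : V) w = 0 := LinearMap.congr_fun hw w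
    exact (hpos w (by simpa using hne)).ne' h
  exact ⟨hinj, (LinearMap.injective_iff_surjective_of_finrank_eq_finrank
    Subspace.dual_finrank_eq.symm).1 hinj⟩

theorem apply_add_self_le {A : V →ₗ[ℝ] Module.Dual ℝ V} (hsymm : ∀ u v, A u v = A v u)
    (hnonneg : ∀ u, 0 ≤ A u u) (u v : V) :
    A (u + v) (u + v) ≤ 2 * A u u + 2 * A v v := by
  have h := hnonneg (u - v)
  simp only [map_sub, map_add, LinearMap.sub_apply, LinearMap.add_apply] at h ⊢
  rw [hsymm v u] at h ⊢
  linarith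

/-- The local solution `A_W⁻¹ I_W^* f ∈ W` of the problem with right-hand side `f`. -/
noncomputable def localSolution (A : V →ₗ[ℝ] Module.Dual ℝ V) (W : Submodule ℝ V)
    (f : Module.Dual ℝ V) : V :=
  W.subtype (linInverse (localOperator A W) (W.subtype.dualMap f))

theorem localSolution_mem (A : V →ₗ[ℝ] Module.Dual ℝ V) (W : Submodule ℝ V)
    (f : Module.Dual ℝ V) : localSolution A W f ∈ W :=
  Subtype.coe_prop _

theorem apply_localSolution [FiniteDimensional ℝ V] {A : V →ₗ[ℝ] Module.Dual ℝ V}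
    (hpos : ∀ u, u ≠ 0 → 0 < A u u) {W : Submodule ℝ V} (f : Module.Dual ℝ V) {w : V}
    (hw : w ∈ W) : A (localSolution A W f) w = f w :=
  LinearMap.congr_fun
    (linInverse_apply_self (localOperator_bijective hpos W) (W.subtype.dualMap f)) ⟨w, hw⟩

variable {ι : Type*} [Fintype ι]

theorem schwarzInverse_apply (A : V →ₗ[ℝ] Module.Dual ℝ V) (W : ι → Submodule ℝ V)
    (f : Module.Dual ℝ V) : schwarzInverse A W f = ∑ i, localSolution A (W i) f := by
  simp [schwarzInverse, localSolution]

theorem dual_schwarzInverse [FiniteDimensional ℝ V] {A : V →ₗ[ℝ] Module.Dual ℝ V}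
    (hpos : ∀ u, u ≠ 0 → 0 < A u u) (W : ι → Submodule ℝ V) (f : Module.Dual ℝ V) :
    f (schwarzInverse A W f) =
      ∑ i, A (localSolution A (W i) f) (localSolution A (W i) f) := by
  rw [schwarzInverse_apply, map_sum]
  exact Finset.sum_congr rfl fun i _ =>
    (apply_localSolution hpos f (localSolution_mem A (W i) f)).symm

theorem schwarzInverse_bijective [FiniteDimensional ℝ V] {A : V →ₗ[ℝ] Module.Dual ℝ V}
    (hpos : ∀ u, u ≠ 0 → 0 < A u u) {W : ι → Submodule ℝ V} (hW : ⨆ i, W i = ⊤) :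
    Function.Bijective (schwarzInverse A W) := by
  have hnonneg : ∀ u, 0 ≤ A u u := fun u => by
    rcases eq_or_ne u 0 with rfl | h
    · simp
    · exact (hpos u h).le
  have hinj : Function.Injective (schwarzInverse A W) := by
    refine (injective_iff_map_eq_zero _).2 fun f hf => ?_
    have h0 := dual_schwarzInverse hpos W f
    rw [hf, map_zero, eq_comm, Finset.sum_eq_zero_iff_of_nonneg fun i _ => hnonneg _] at h0
    have hle : ⨆ i, W i ≤ LinearMap.ker f := iSup_le fun i w hw => by
      have hz : localSolution A (W i) f = 0 := by
        by_contra hne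
        exact (hpos _ hne).ne' (h0 i (Finset.mem_univ i))
      rw [LinearMap.mem_ker, ← apply_localSolution hpos f hw, hz]
      simp
    rw [hW, top_le_iff] at hle
    exact LinearMap.ker_eq_top.1 hle
  exact ⟨hinj, (LinearMap.injective_iff_surjective_of_finrank_eq_finrank
    Subspace.dual_finrank_eq).1 hinj⟩

/-- The energy `⟨D u, u⟩` is attained by the splitting of `u` into the local solutions with
right-hand side `D u`. -/
theorem exists_splitting_schwarz_eq [FiniteDimensional ℝ V] {A : V →ₗ[ℝ] Module.Dual ℝ V}
    (hpos : ∀ u, u ≠ 0 → 0 < A u u) {W : ι → Submodule ℝ V} (hW : ⨆ i, W i = ⊤) (u : V) :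
    ∃ w : ι → V, (∀ i, w i ∈ W i) ∧ ∑ i, w i = u ∧
      schwarz A W u u = ∑ i, A (w i) (w i) := by
  have h := linInverse_apply_self (schwarzInverse_bijective hpos hW) u
  refine ⟨fun i => localSolution A (W i) (schwarz A W u), fun i => localSolution_mem _ _ _,
    (schwarzInverse_apply A W _).symm.trans h, ?_⟩
  rw [← dual_schwarzInverse hpos W]
  exact congrArg _ h.symm

/-- The energy `⟨D u, u⟩` is minimal among the energies of all splittings of `u`. -/
theorem schwarz_le_of_splitting [FiniteDimensional ℝ V] {A : V →ₗ[ℝ] Module.Dual ℝ V}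
    (hsymm : ∀ u v, A u v = A v u) (hpos : ∀ u, u ≠ 0 → 0 < A u u) {W : ι → Submodule ℝ V}
    (hW : ⨆ i, W i = ⊤) {u : V} {w : ι → V} (hw : ∀ i, w i ∈ W i) (hu : ∑ i, w i = u) :
    schwarz A W u u ≤ ∑ i, A (w i) (w i) := by
  have hnonneg : ∀ u, 0 ≤ A u u := fun u => by
    rcases eq_or_ne u 0 with rfl | h
    · simp
    · exact (hpos u h).le
  set f := schwarz A W u with hf
  have hSf : schwarzInverse A W f = u :=
    linInverse_apply_self (schwarzInverse_bijective hpos hW) u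
  have h1 : f u = ∑ i, A (localSolution A (W i) f) (localSolution A (W i) f) := by
    rw [← dual_schwarzInverse hpos W, hSf]
  have h2 : f u = ∑ i, A (localSolution A (W i) f) (w i) := by
    rw [← hu, map_sum]
    exact Finset.sum_congr rfl fun i _ => (apply_localSolution hpos f (hw i)).symm
  -- Cauchy–Schwarz in the form `2 A(x, y) ≤ A(x, x) + A(y, y)`, summed over the subspaces
  have h3 : 2 * f u ≤ f u + ∑ i, A (w i) (w i) := by
    conv_lhs => rw [h2]
    conv_rhs => rw [h1]
    rw [← Finset.sum_add_distrib, Finset.mul_sum]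
    refine Finset.sum_le_sum fun i _ => ?_
    have h := hnonneg (localSolution A (W i) f - w i)
    simp only [map_sub, LinearMap.sub_apply] at h
    rw [hsymm (w i)] at h
    linarith
  linarith

end Abstract

/-! ### Overlap: pointwise estimates -/

section Overlap

/-- The Cauchy–Schwarz inequality for a sum with at most `N` nonzero terms at almost every
point. -/
theorem norm_sum_sq_le_of_encard_le {α : Type*} [MeasurableSpace α] {μ : Measure α} {ι : Type*}
    [Fintype ι] (g : ι → Lp ℝ 2 μ) {N : ℕ} (h : ∀ᵐ x ∂μ, {i | g i x ≠ 0}.encard ≤ N) :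
    ‖∑ i, g i‖ ^ 2 ≤ N * ∑ i, ‖g i‖ ^ 2 := by
  classical
  have hsq : ∀ f : Lp ℝ 2 μ, ‖f‖ ^ 2 = ∫ x, f x ^ 2 ∂μ := fun f => by
    rw [← real_inner_self_eq_norm_sq, L2.inner_def]
    simp [pow_two]
  have hint : ∀ f : Lp ℝ 2 μ, Integrable (fun x => f x ^ 2) μ := fun f =>
    (Lp.memLp f).integrable_sq
  simp only [hsq]
  rw [← integral_finsetSum _ fun i _ => hint (g i), ← integral_const_mul]
  refine integral_mono_ae (hint _)
    ((integrable_finsetSum _ fun i _ => hint (g i)).const_mul _) ?_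
  filter_upwards [h, Lp.coeFn_finsetSum Finset.univ g] with x hx hs
  have hcard : ((Finset.univ.filter fun i => g i x ≠ 0).card : ℝ) ≤ N := by
    have : ({i | g i x ≠ 0} : Set ι) = (Finset.univ.filter fun i => g i x ≠ 0) := by
      ext i; simp
    rw [this, Set.encard_coe_eq_coe_finsetCard] at hx
    exact_mod_cast hx
  rw [hs, Finset.sum_apply]
  calc (∑ i, g i x) ^ 2 = (∑ i with g i x ≠ 0, g i x) ^ 2 := by rw [Finset.sum_filter_ne_zero]
    _ ≤ (Finset.univ.filter fun i => g i x ≠ 0).card * ∑ i with g i x ≠ 0, g i x ^ 2 :=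
      sq_sum_le_card_mul_sum_sq
    _ ≤ N * ∑ i, g i x ^ 2 := by
      refine mul_le_mul hcard (Finset.sum_le_sum_of_subset_of_nonneg (Finset.filter_subset _ _)
        fun i _ _ => sq_nonneg _) (Finset.sum_nonneg fun i _ => sq_nonneg _) (Nat.cast_nonneg _)

variable {d : ℕ} {Ω : Set (EuclideanSpace ℝ (Fin d))}

/-- The weak gradient vanishes almost everywhere on a relatively open set on which the field
does. -/
theorem ae_grad_eq_zero_of_ae_comp_eq_zero (hΩ : IsOpen Ω) (v : H1 Ω) (i j : Fin d)
    {U : Set (EuclideanSpace ℝ (Fin d))} (hU : IsOpen U)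
    (h : ∀ᵐ y ∂volume.restrict (Ω ∩ U), comp i v y = 0) :
    ∀ᵐ x ∂volume.restrict Ω, x ∈ Ω ∩ U → grad i j v x = 0 := by
  refine (hΩ.inter hU).ae_eq_zero_of_integral_contDiff_smul_eq_zero
    (((Lp.memLp (grad i j v)).locallyIntegrable (by norm_num)).locallyIntegrableOn _)
    fun φ hφ hc hs => ?_
  have hweak := v.2 i j φ hφ hc (hs.trans Set.inter_subset_left)
  have hz : ∀ᵐ x ∂volume.restrict Ω, x ∈ U → comp i v x = 0 := by
    rw [Set.inter_comm, ← Measure.restrict_restrict hU.measurableSet] at h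
    exact (ae_restrict_iff' hU.measurableSet).1 h
  have h0 : ∫ x in Ω, comp i v x * fderiv ℝ φ x (EuclideanSpace.single j 1) = 0 := by
    refine integral_eq_zero_of_ae ?_
    filter_upwards [hz] with x hx
    by_cases hxU : x ∈ U
    · simp [hx hxU]
    · have : fderiv ℝ φ x = 0 := by
        refine image_eq_zero_of_notMem_tsupport fun hmem => hxU ?_
        exact (hs (tsupport_fderiv_subset ℝ hmem)).2
      simp [this]
  have h1 := hweak.symm.trans h0
  rw [neg_eq_zero] at h1
  simp only [smul_eq_mul, mul_comm (φ _)]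
  exact h1

/-- The weak gradient of a field vanishes almost everywhere off its support. The complement of
the support is covered by open sets on which the field vanishes; countably many suffice. -/
theorem ae_grad_eq_zero_of_notMem_fieldSupport (hΩ : IsOpen Ω) (v : H1 Ω) (i j : Fin d) :
    ∀ᵐ x ∂volume.restrict Ω, x ∉ fieldSupport v → grad i j v x = 0 := by
  have hnull : volume.restrict Ω {x | x ∈ Ω ∧ x ∉ fieldSupport v ∧ grad i j v x ≠ 0} = 0 := by
    refine measure_null_of_locally_null _ fun x ⟨hxΩ, hxs, _⟩ => ?_
    obtain ⟨U, hU, hxU, hz⟩ : ∃ U, IsOpen U ∧ x ∈ U ∧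
        ∀ i, ∀ᵐ y ∂volume.restrict (Ω ∩ U), comp i v y = 0 := by
      by_contra hne
      exact hxs ⟨hxΩ, hne⟩
    refine ⟨U ∩ {x | x ∈ Ω ∧ x ∉ fieldSupport v ∧ grad i j v x ≠ 0},
      Filter.inter_mem (mem_nhdsWithin_of_mem_nhds (hU.mem_nhds hxU)) self_mem_nhdsWithin, ?_⟩
    refine measure_mono_null ?_ (ae_grad_eq_zero_of_ae_comp_eq_zero hΩ v i j hU (hz i))
    rintro y ⟨hyU, hyΩ, -, hy⟩ hmem
    exact hy (hmem ⟨hyΩ, hyU⟩)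
  filter_upwards [measure_eq_zero_iff_ae_notMem.1 hnull, ae_restrict_mem hΩ.measurableSet]
    with x hx hxΩ hxs
  by_contra hne
  exact hx ⟨hxΩ, hxs, hne⟩

theorem ae_symGrad_eq_zero_of_notMem_fieldSupport (hΩ : IsOpen Ω) (v : H1 Ω) (i j : Fin d) :
    ∀ᵐ x ∂volume.restrict Ω, x ∉ fieldSupport v → symGrad i j v x = 0 := by
  have h1 : symGrad i j v = (1 / 2 : ℝ) • (grad i j v + grad j i v) := rfl
  rw [h1]
  filter_upwards [ae_grad_eq_zero_of_notMem_fieldSupport hΩ v i j,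
    ae_grad_eq_zero_of_notMem_fieldSupport hΩ v j i,
    Lp.coeFn_smul (1 / 2 : ℝ) (grad i j v + grad j i v),
    Lp.coeFn_add (grad i j v) (grad j i v)] with x ha hb hc he hx
  rw [hc, Pi.smul_apply, he, Pi.add_apply, ha hx, hb hx]
  simp

theorem ae_div_eq_zero_of_notMem_fieldSupport (hΩ : IsOpen Ω) (v : H1 Ω) :
    ∀ᵐ x ∂volume.restrict Ω, x ∉ fieldSupport v → div v x = 0 := by
  have h1 : div v = ∑ i, grad i i v := by simp [div]
  rw [h1]
  have hg := ae_all_iff.2 fun i => ae_grad_eq_zero_of_notMem_fieldSupport hΩ v i i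
  filter_upwards [hg, Lp.coeFn_finsetSum Finset.univ fun i => grad i i v] with x ha hs hx
  rw [hs, Finset.sum_apply]
  exact Finset.sum_eq_zero fun i _ => ha i hx

/-- A local linear operator `T : H¹ → L²` is almost orthogonal on subspaces with overlap `N`. -/
theorem norm_map_sum_sq_le_of_overlapLE {Vh : Submodule ℝ (H1 Ω)} {ι : Type*} [Fintype ι]
    {W : ι → Submodule ℝ Vh} {N : ℕ} (hN : OverlapLE W N) (T : H1 Ω →ₗ[ℝ] L2 Ω)
    (hT : ∀ v, ∀ᵐ x ∂volume.restrict Ω, x ∉ fieldSupport v → T v x = 0)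
    {w : ι → Vh} (hw : ∀ i, w i ∈ W i) :
    ‖T (∑ i, w i : Vh)‖ ^ 2 ≤ N * ∑ i, ‖T (w i)‖ ^ 2 := by
  rw [Submodule.coe_sum, map_sum]
  refine norm_sum_sq_le_of_encard_le _ ?_
  filter_upwards [hN, ae_all_iff.2 fun i => hT (w i)] with x hx hz
  refine (Set.encard_le_encard fun i hi => ?_).trans hx
  by_contra hmem
  exact hi (hz i fun hs => hmem (Set.mem_biUnion (hw i) hs))

end Overlap

/-! ### Estimates for the forms -/

section Forms

variable {d : ℕ} {Ω : Set (EuclideanSpace ℝ (Fin d))}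

theorem aForm_apply (u v : H1 Ω) :
    aForm u v = ∑ i, ∑ j, inner ℝ (symGrad i j u) (symGrad i j v) := by
  simp [aForm, LinearMap.sum_apply]

theorem aForm_self (u : H1 Ω) : aForm u u = ∑ i, ∑ j, ‖symGrad i j u‖ ^ 2 := by
  simp [aForm_apply]

theorem aForm_nonneg (u : H1 Ω) : 0 ≤ aForm u u := by
  rw [aForm_self]
  positivity

theorem aForm_symm (u v : H1 Ω) : aForm u v = aForm v u := by
  simp only [aForm_apply, real_inner_comm]

theorem norm1_nonneg (u : H1 Ω) : 0 ≤ norm1 u := Real.sqrt_nonneg _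

theorem norm1_sq (u : H1 Ω) :
    norm1 u ^ 2 = ∑ i, ‖comp i u‖ ^ 2 + ∑ i, ∑ j, ‖grad i j u‖ ^ 2 :=
  Real.sq_sqrt (by positivity)

theorem norm0_sq (u : H1 Ω) : norm0 u ^ 2 = ∑ i, ‖comp i u‖ ^ 2 :=
  Real.sq_sqrt (by positivity)

theorem norm0_sq_le_norm1_sq (u : H1 Ω) : norm0 u ^ 2 ≤ norm1 u ^ 2 := by
  rw [norm0_sq, norm1_sq]
  exact le_add_of_nonneg_right (by positivity)

theorem norm0_sub_sq_le (u v : H1 Ω) :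
    norm0 (u - v) ^ 2 ≤ 2 * norm0 u ^ 2 + 2 * norm0 v ^ 2 := by
  simp only [norm0_sq, Finset.mul_sum, ← Finset.sum_add_distrib]
  refine Finset.sum_le_sum fun i _ => ?_
  rw [map_sub]
  have := parallelogram_law_with_norm ℝ (comp i u) (comp i v)
  nlinarith [sq_nonneg ‖comp i u + comp i v‖]

theorem eq_zero_of_norm1_eq_zero {u : H1 Ω} (h : norm1 u = 0) : u = 0 := by
  have h2 := norm1_sq u
  rw [h, zero_pow two_ne_zero, eq_comm, add_eq_zero_iff_of_nonneg (by positivity) (by positivity),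
    Finset.sum_eq_zero_iff_of_nonneg fun i _ => by positivity,
    Finset.sum_eq_zero_iff_of_nonneg fun i _ => by positivity] at h2
  refine Subtype.ext (Prod.ext (funext fun i => ?_) (funext fun i => funext fun j => ?_))
  · have := h2.1 i (Finset.mem_univ i)
    exact norm_eq_zero.1 (pow_eq_zero_iff two_ne_zero |>.1 this)
  · have := h2.2 i (Finset.mem_univ i)
    rw [Finset.sum_eq_zero_iff_of_nonneg fun i _ => by positivity] at this
    exact norm_eq_zero.1 (pow_eq_zero_iff two_ne_zero |>.1 (this j (Finset.mem_univ j)))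

theorem aForm_self_le_norm1_sq (u : H1 Ω) : aForm u u ≤ norm1 u ^ 2 := by
  have h : ∀ i j, ‖symGrad i j u‖ ^ 2 ≤ 1 / 2 * (‖grad i j u‖ ^ 2 + ‖grad j i u‖ ^ 2) := by
    intro i j
    have h1 : symGrad i j u = (1 / 2 : ℝ) • (grad i j u + grad j i u) := rfl
    rw [h1, norm_smul, mul_pow, Real.norm_of_nonneg (by norm_num)]
    have := parallelogram_law_with_norm ℝ (grad i j u) (grad j i u)
    nlinarith [sq_nonneg ‖grad i j u - grad j i u‖]
  calc aForm u u ≤ ∑ i, ∑ j, 1 / 2 * (‖grad i j u‖ ^ 2 + ‖grad j i u‖ ^ 2) := by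
        rw [aForm_self]
        exact Finset.sum_le_sum fun i _ => Finset.sum_le_sum fun j _ => h i j
    _ = ∑ i, ∑ j, ‖grad i j u‖ ^ 2 := by
        simp only [← Finset.mul_sum, Finset.sum_add_distrib]
        rw [Finset.sum_comm (f := fun i j => ‖grad j i u‖ ^ 2)]
        ring
    _ ≤ norm1 u ^ 2 := by
        rw [norm1_sq]
        exact le_add_of_nonneg_left (by positivity)

theorem norm_div_sq_le (u : H1 Ω) : ‖div u‖ ^ 2 ≤ d * aForm u u := by
  have h1 : div u = ∑ i, symGrad i i u := by
    rw [div, LinearMap.sum_apply]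
    refine Finset.sum_congr rfl fun i _ => ?_
    have h2 : symGrad i i u = (1 / 2 : ℝ) • (grad i i u + grad i i u) := rfl
    rw [h2, ← two_smul ℝ, smul_smul]
    norm_num
  calc ‖div u‖ ^ 2 ≤ (∑ i, ‖symGrad i i u‖) ^ 2 := by
        rw [h1]
        gcongr
        exact norm_sum_le _ _
    _ ≤ d * ∑ i, ‖symGrad i i u‖ ^ 2 := by
        simpa using sq_sum_le_card_mul_sum_sq (s := Finset.univ)
          (f := fun i : Fin d => ‖symGrad i i u‖)
    _ ≤ d * aForm u u := by
        rw [aForm_self]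
        gcongr with i
        exact Finset.single_le_sum (f := fun j => ‖symGrad i j u‖ ^ 2)
          (fun j _ => by positivity) (Finset.mem_univ i)

theorem aForm_le_sqrt_mul_norm1 (u v : H1 Ω) : aForm u v ≤ √(aForm u u) * norm1 v := by
  have h : aForm u v ^ 2 ≤ aForm u u * aForm v v := by
    have := LinearMap.BilinForm.apply_mul_apply_le_of_forall_zero_le (aForm (Ω := Ω))
      aForm_nonneg u v
    rwa [aForm_symm v u, ← pow_two] at this
  refine le_of_sq_le_sq ?_ (mul_nonneg (Real.sqrt_nonneg _) (norm1_nonneg v))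
  rw [mul_pow, Real.sq_sqrt (aForm_nonneg u)]
  exact h.trans (mul_le_mul_of_nonneg_left (aForm_self_le_norm1_sq v) (aForm_nonneg u))

variable (Qh : Submodule ℝ (L2 Ω)) [FiniteDimensional ℝ Qh]

theorem cForm_self (u : H1 Ω) : cForm Qh u u = ‖discreteDiv Qh u‖ ^ 2 := by
  simp [cForm]

theorem cForm_symm (u v : H1 Ω) : cForm Qh u v = cForm Qh v u := by
  simp [cForm, real_inner_comm]

theorem inner_discreteDiv (u : H1 Ω) {q : L2 Ω} (hq : q ∈ Qh) :
    inner ℝ (discreteDiv Qh u) q = inner ℝ (div u) q := by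
  change inner ℝ (Qh.starProjection (div u)) q = _
  rw [Submodule.inner_starProjection_left_eq_right, Submodule.starProjection_eq_self_iff.2 hq]

theorem cForm_self_le (u : H1 Ω) : cForm Qh u u ≤ d * aForm u u := by
  rw [cForm_self]
  refine le_trans ?_ (norm_div_sq_le u)
  gcongr
  exact Qh.norm_starProjection_apply_le (div u)

variable {Qh} in
theorem operatorA_self {Vh : Submodule ℝ (H1 Ω)} (γ : ℝ) (u : Vh) :
    operatorA Vh Qh γ u u = aForm (u : H1 Ω) u + γ * cForm Qh u u := by
  simp [operatorA]

variable {Qh} in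
theorem operatorA_symm {Vh : Submodule ℝ (H1 Ω)} (γ : ℝ) (u v : Vh) :
    operatorA Vh Qh γ u v = operatorA Vh Qh γ v u := by
  simp [operatorA, aForm_symm (u : H1 Ω), cForm_symm Qh (u : H1 Ω)]

variable {Qh} in
theorem operatorA_add_self_le {Vh : Submodule ℝ (H1 Ω)} {γ : ℝ} (hγ : 0 ≤ γ) (u v : Vh) :
    operatorA Vh Qh γ (u + v) (u + v) ≤
      2 * operatorA Vh Qh γ u u + 2 * operatorA Vh Qh γ v v := by
  refine apply_add_self_le (V := Vh) (operatorA_symm γ) (fun w => ?_) u v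
  rw [operatorA_self, cForm_self]
  have := aForm_nonneg (w : H1 Ω)
  positivity

end Forms

/-! ### Consequences of the inf-sup condition -/

section InfSup

variable {d : ℕ} {Ω : Set (EuclideanSpace ℝ (Fin d))} {Vh : Submodule ℝ (H1 Ω)}
  {Qh : Submodule ℝ (L2 Ω)} {β : ℝ}

theorem InfSupStable.mul_le (h : InfSupStable Vh Qh β) (u : Vh) (p : Qh) {K : ℝ} (hK : 0 ≤ K)
    (hB : ∀ (v : Vh) (q : Qh), mixedForm (u : H1 Ω) p v q ≤ K * (norm1 (v : H1 Ω) + ‖q‖)) :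
    β * (norm1 (u : H1 Ω) + ‖p‖) ≤ K := by
  rw [← EReal.coe_le_coe_iff]
  refine (h u p).trans (iSup_le fun v => iSup_le fun q => EReal.coe_le_coe_iff.2 ?_)
  exact div_le_of_le_mul₀ (add_nonneg (norm1_nonneg _) (norm_nonneg _)) hK (hB v q)

/-- The discrete Korn inequality: the inf-sup condition at `p = 0`. -/
theorem InfSupStable.norm1_sq_le (h : InfSupStable Vh Qh β) (hβ : 0 < β) (u : Vh) :
    β ^ 2 * norm1 (u : H1 Ω) ^ 2 ≤ (d + 1) * aForm (u : H1 Ω) u := by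
  have ha := aForm_nonneg (u : H1 Ω)
  have hb : ‖div (u : H1 Ω)‖ ≤ √d * √(aForm (u : H1 Ω) u) := by
    rw [← Real.sqrt_mul (Nat.cast_nonneg d)]
    exact Real.le_sqrt_of_sq_le (norm_div_sq_le _)
  have hd1 : 1 ≤ √((d : ℝ) + 1) := Real.one_le_sqrt.2 (by simp)
  have hd2 : √(d : ℝ) ≤ √((d : ℝ) + 1) := Real.sqrt_le_sqrt (by simp)
  have hle := h.mul_le u 0 (K := √((d : ℝ) + 1) * √(aForm (u : H1 Ω) u)) (by positivity)
    fun v q => by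
      have h1 := aForm_le_sqrt_mul_norm1 (u : H1 Ω) v
      have h2 : -(inner ℝ (div (u : H1 Ω)) (q : L2 Ω)) ≤ ‖div (u : H1 Ω)‖ * ‖q‖ :=
        (neg_le_abs _).trans (abs_real_inner_le_norm _ _)
      have h3 : √(aForm (u : H1 Ω) u) * norm1 (v : H1 Ω) ≤
          √((d : ℝ) + 1) * √(aForm (u : H1 Ω) u) * norm1 (v : H1 Ω) :=
        mul_le_mul_of_nonneg_right (le_mul_of_one_le_left (Real.sqrt_nonneg _) hd1)
          (norm1_nonneg _)
      have h4 : ‖div (u : H1 Ω)‖ * ‖q‖ ≤ √((d : ℝ) + 1) * √(aForm (u : H1 Ω) u) * ‖q‖ :=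
        mul_le_mul_of_nonneg_right
          (hb.trans (mul_le_mul_of_nonneg_right hd2 (Real.sqrt_nonneg _))) (norm_nonneg _)
      simp only [mixedForm, ZeroMemClass.coe_zero, inner_zero_right]
      linarith
  rw [norm_zero, add_zero] at hle
  have := pow_le_pow_left₀ (mul_nonneg hβ.le (norm1_nonneg _)) hle 2
  rwa [mul_pow, mul_pow, Real.sq_sqrt (by positivity), Real.sq_sqrt ha] at this

variable [FiniteDimensional ℝ Qh]

theorem InfSupStable.operatorA_pos (h : InfSupStable Vh Qh β) (hβ : 0 < β) {γ : ℝ} (hγ : 0 ≤ γ)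
    (u : Vh) (hu : u ≠ 0) : 0 < operatorA Vh Qh γ u u := by
  have hn : 0 < norm1 (u : H1 Ω) := (norm1_nonneg _).lt_of_ne fun h0 =>
    hu (Subtype.ext (eq_zero_of_norm1_eq_zero h0.symm))
  have hk := h.norm1_sq_le hβ u
  have ha : 0 < aForm (u : H1 Ω) u := by
    have : 0 < β ^ 2 * norm1 (u : H1 Ω) ^ 2 := by positivity
    exact pos_of_mul_pos_right (this.trans_le hk) (by positivity)
  rw [operatorA_self, cForm_self]
  positivity

theorem surjective_of_injective_prod_dual {V Q : Type*} [AddCommGroup V] [Module ℝ V]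
    [FiniteDimensional ℝ V] [AddCommGroup Q] [Module ℝ Q] [FiniteDimensional ℝ Q]
    (T : (V × Q) →ₗ[ℝ] (Module.Dual ℝ V × Module.Dual ℝ Q)) (h : Function.Injective T) :
    Function.Surjective T :=
  (LinearMap.injective_iff_surjective_of_finrank_eq_finrank (by
    rw [Module.finrank_prod, Module.finrank_prod, Subspace.dual_finrank_eq,
      Subspace.dual_finrank_eq])).1 h

/-- Every discrete divergence is attained by a field of comparable `H¹` norm: the velocity of the
solution of the mixed problem with right-hand side `(0, Π (∇ · u))`, which is solvable since the
inf-sup condition makes the square linear system injective. -/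
theorem InfSupStable.exists_discreteDiv_eq [FiniteDimensional ℝ Vh] (h : InfSupStable Vh Qh β)
    (hβ : 0 < β) (u : Vh) :
    ∃ v : Vh, discreteDiv Qh (v : H1 Ω) = discreteDiv Qh (u : H1 Ω) ∧
      β * norm1 (v : H1 Ω) ≤ ‖discreteDiv Qh (u : H1 Ω)‖ := by
  let b : Vh →ₗ[ℝ] Qh →ₗ[ℝ] ℝ := (innerₗ (L2 Ω)).compl₁₂ (div ∘ₗ Vh.subtype) Qh.subtype
  let a : Vh →ₗ[ℝ] Vh →ₗ[ℝ] ℝ := aForm.compl₁₂ Vh.subtype Vh.subtype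
  -- the operator `(w, p) ↦ (a(w, ·) - b(·, p), -b(w, ·))` of the mixed problem
  let T : (Vh × Qh) →ₗ[ℝ] (Module.Dual ℝ Vh × Module.Dual ℝ Qh) :=
    ((a ∘ₗ LinearMap.fst ℝ Vh Qh) - (b.flip ∘ₗ LinearMap.snd ℝ Vh Qh)).prod
      (-(b ∘ₗ LinearMap.fst ℝ Vh Qh))
  have hT : ∀ (w : Vh) (p : Qh) (v : Vh) (q : Qh),
      mixedForm (w : H1 Ω) p v q = (T (w, p)).1 v + (T (w, p)).2 q := fun w p v q => by
    simp [T, a, b, mixedForm]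
    ring
  have hinj : Function.Injective T := by
    refine (injective_iff_map_eq_zero _).2 ?_
    rintro ⟨w, p⟩ hw
    have := h.mul_le w p le_rfl fun v q => by rw [hT, hw]; simp
    have hw1 := norm1_nonneg (w : H1 Ω)
    have hs : norm1 (w : H1 Ω) + ‖p‖ ≤ 0 := nonpos_of_mul_nonpos_right this hβ
    have hp := norm_nonneg p
    exact Prod.ext (Subtype.ext (eq_zero_of_norm1_eq_zero (by linarith)))
      (norm_eq_zero.1 (by linarith))
  have hsurj : Function.Surjective T :=
    surjective_of_injective_prod_dual (V := Vh) (Q := Qh) T hinj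
  obtain ⟨⟨v, p⟩, hv⟩ := hsurj (0, -b u)
  have hdiv : ∀ q : Qh, b v q = b u q := fun q => by
    have := LinearMap.congr_fun (congrArg Prod.snd hv) q
    simpa [T] using this
  refine ⟨v, ?_, ?_⟩
  · change Qh.starProjection (div (v : H1 Ω)) = Qh.starProjection (div (u : H1 Ω))
    rw [← sub_eq_zero, ← map_sub, Submodule.starProjection_apply_eq_zero_iff,
      Submodule.mem_orthogonal']
    intro q hq
    rw [inner_sub_left, sub_eq_zero]
    exact hdiv ⟨q, hq⟩
  · have hle := h.mul_le v p (norm_nonneg (discreteDiv Qh (u : H1 Ω))) fun w q => by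
      have h1 : -(inner ℝ (discreteDiv Qh (u : H1 Ω)) (q : L2 Ω)) ≤
          ‖discreteDiv Qh (u : H1 Ω)‖ * ‖q‖ :=
        (neg_le_abs _).trans (abs_real_inner_le_norm _ _)
      rw [inner_discreteDiv Qh _ q.2] at h1
      have h2 := mul_nonneg (norm_nonneg (discreteDiv Qh (u : H1 Ω))) (norm1_nonneg (w : H1 Ω))
      have h3 : b u q = inner ℝ (div (u : H1 Ω)) (q : L2 Ω) := rfl
      rw [hT, hv, LinearMap.zero_apply, zero_add, LinearMap.neg_apply, h3]
      linarith
    exact (mul_le_mul_of_nonneg_left (le_add_of_nonneg_right (norm_nonneg p)) hβ.le).trans hle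

end InfSup

/-! ### The two spectral bounds -/

section Bounds

variable {d : ℕ} {Ω : Set (EuclideanSpace ℝ (Fin d))} {Vh : Submodule ℝ (H1 Ω)}
  {ι : Type*} [Fintype ι]

/-- Splittings whose energy is as close to the infimum as desired. -/
theorem exists_splitting_of_splittingEnergy_le {W : ι → Submodule ℝ Vh} {u : Vh} {c ε : ℝ}
    (hc : 0 ≤ c) (hε : 0 < ε) (h : splittingEnergy W u ≤ ENNReal.ofReal c) :
    ∃ w : ι → Vh, (∀ i, w i ∈ W i) ∧ ∑ i, w i = u ∧
      ∑ i, norm1 (w i : H1 Ω) ^ 2 ≤ c + ε := by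
  have hlt : splittingEnergy W u < ENNReal.ofReal (c + ε) :=
    h.trans_lt ((ENNReal.ofReal_lt_ofReal_iff (by linarith)).2 (by linarith))
  simp only [splittingEnergy, iInf_lt_iff] at hlt
  obtain ⟨w, hw, hlt⟩ := hlt
  exact ⟨w, hw.1, hw.2, ((ENNReal.ofReal_lt_ofReal_iff (by linarith)).1 hlt).le⟩

variable {Qh : Submodule ℝ (L2 Ω)} [FiniteDimensional ℝ Qh]

theorem operatorA_self_le_of_mem_discreteKernel (γ : ℝ) {z : Vh} (hz : z ∈ discreteKernel Vh Qh) :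
    operatorA Vh Qh γ z z ≤ norm1 (z : H1 Ω) ^ 2 := by
  have h0 : discreteDiv Qh (z : H1 Ω) = 0 := hz
  rw [operatorA_self, cForm_self, h0]
  simpa using aForm_self_le_norm1_sq (z : H1 Ω)

theorem operatorA_self_le {γ : ℝ} (hγ : 0 ≤ γ) (w : Vh) :
    operatorA Vh Qh γ w w ≤ (1 + γ * d) * norm1 (w : H1 Ω) ^ 2 := by
  rw [operatorA_self]
  calc _ ≤ aForm (w : H1 Ω) (w : H1 Ω) + γ * (d * aForm (w : H1 Ω) (w : H1 Ω)) := by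
        gcongr
        exact cForm_self_le Qh (w : H1 Ω)
    _ = (1 + γ * d) * aForm (w : H1 Ω) (w : H1 Ω) := by ring
    _ ≤ _ := by
        gcongr
        exact aForm_self_le_norm1_sq _

/-- The arithmetic of the stable splitting: `a` and `c` stand for the values of the two forms, the
squared inf-sup constant is `b`, and `δ` is the excess of the two partial splittings. -/
theorem splitting_bound {a b c c₁ c₂ d γ : ℝ} (hd : 0 ≤ d) (hγ : 0 ≤ γ) (hc₁ : 0 ≤ c₁)
    (hc₂ : 0 ≤ c₂) (hb : 0 < b) (ha : 0 ≤ a) (hc : 0 ≤ c) (hca : c ≤ d * a) (δ : ℝ) :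
    2 * (c₂ * ((4 * d + 2) * a / b) + δ) + 2 * (1 + γ * d) * (c₁ * (c / b) + δ) ≤
      (c₁ + c₂) * ((8 * d + 4) / b * (a + γ * c)) + (2 * (1 + γ * d) + 2) * δ := by
  have hg : 0 ≤ γ * c := mul_nonneg hγ hc
  have hdg : 0 ≤ d * (γ * c) := mul_nonneg hd hg
  have hda : 0 ≤ d * a := mul_nonneg hd ha
  calc _ = (c₂ * ((8 * d + 4) * a) + c₁ * (2 * (c + d * (γ * c)))) / b +
          (2 * (1 + γ * d) + 2) * δ := by ring
    _ ≤ (c₂ * ((8 * d + 4) * (a + γ * c)) + c₁ * ((8 * d + 4) * (a + γ * c))) / b +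
          (2 * (1 + γ * d) + 2) * δ := by
        gcongr (c₂ * ?_ + c₁ * ?_) / b + _
        · linarith
        · linarith
    _ = _ := by ring

/-- Splitting `u = (u - v) + v` with `v` of comparable `H¹` norm and `u - v` discretely
divergence-free gives a splitting of `u` whose energy is bounded uniformly in `γ`. -/
theorem schwarz_operatorA_le [FiniteDimensional ℝ Vh] {β : ℝ} (hβ : 0 < β)
    (hstab : InfSupStable Vh Qh β) {W : ι → Submodule ℝ Vh} (hW : ⨆ i, W i = ⊤) {c₁ c₂ : ℝ}
    (hc₁ : 0 ≤ c₁) (hc₂ : 0 ≤ c₂)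
    (h₁ : ∀ u : Vh, splittingEnergy W u ≤ ENNReal.ofReal (c₁ * norm0 (u : H1 Ω) ^ 2))
    (h₂ : ∀ u ∈ discreteKernel Vh Qh, splittingEnergy (fun i => discreteKernel Vh Qh ⊓ W i) u ≤
      ENNReal.ofReal (c₂ * norm0 (u : H1 Ω) ^ 2))
    {γ : ℝ} (hγ : 0 ≤ γ) (u : Vh) :
    schwarz (operatorA Vh Qh γ) W u u ≤
      (c₁ + c₂) * ((8 * d + 4) / β ^ 2 * operatorA Vh Qh γ u u) := by
  obtain ⟨v, hv, hvn⟩ := hstab.exists_discreteDiv_eq hβ u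
  have hker : u - v ∈ discreteKernel Vh Qh := by
    simp [discreteKernel, hv]
  have hcu : cForm Qh (u : H1 Ω) u = ‖discreteDiv Qh (u : H1 Ω)‖ ^ 2 := cForm_self Qh _
  have hcn : 0 ≤ cForm Qh (u : H1 Ω) u := hcu ▸ sq_nonneg _
  have hc := cForm_self_le Qh (u : H1 Ω)
  have ha := aForm_nonneg (u : H1 Ω)
  have hkorn := hstab.norm1_sq_le hβ u
  have hv1 : β ^ 2 * norm1 (v : H1 Ω) ^ 2 ≤ cForm Qh (u : H1 Ω) u := by
    rw [hcu, ← mul_pow]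
    exact pow_le_pow_left₀ (mul_nonneg hβ.le (norm1_nonneg _)) hvn 2
  have hβ2 : 0 < β ^ 2 := by positivity
  have hv0 : norm0 (v : H1 Ω) ^ 2 ≤ cForm Qh (u : H1 Ω) u / β ^ 2 :=
    (norm0_sq_le_norm1_sq _).trans ((le_div_iff₀' hβ2).2 hv1)
  have hu0 : norm0 ((u - v : Vh) : H1 Ω) ^ 2 ≤
      (4 * d + 2) * aForm (u : H1 Ω) u / β ^ 2 := by
    rw [le_div_iff₀' hβ2]
    have h := norm0_sub_sq_le (u : H1 Ω) v
    have hu' := norm0_sq_le_norm1_sq (u : H1 Ω)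
    have hv' := norm0_sq_le_norm1_sq (v : H1 Ω)
    calc β ^ 2 * norm0 ((u - v : Vh) : H1 Ω) ^ 2
        ≤ β ^ 2 * (2 * norm1 (u : H1 Ω) ^ 2 + 2 * norm1 (v : H1 Ω) ^ 2) :=
          mul_le_mul_of_nonneg_left (h.trans (by linarith)) hβ2.le
      _ ≤ (4 * d + 2) * aForm (u : H1 Ω) u := by linarith
  have hA := operatorA_self (Qh := Qh) γ u
  refine le_of_forall_pos_le_add fun ε hε => ?_
  -- the excess `δ` enters the energy with the factor `2 (1 + γ d) + 2`
  obtain ⟨δ, hδ, hδε⟩ : ∃ δ : ℝ, 0 < δ ∧ (2 * (1 + γ * d) + 2) * δ = ε :=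
    ⟨ε / (2 * (1 + γ * d) + 2), by positivity, by field_simp⟩
  obtain ⟨w, hw, hws, hwn⟩ :=
    exists_splitting_of_splittingEnergy_le (by positivity) hδ (h₁ v)
  obtain ⟨z, hz, hzs, hzn⟩ :=
    exists_splitting_of_splittingEnergy_le (by positivity) hδ (h₂ _ hker)
  have hsplit : ∑ i, (z i + w i) = u := by
    rw [Finset.sum_add_distrib, hzs, hws]
    exact sub_add_cancel (G := Vh) u v
  calc schwarz (operatorA Vh Qh γ) W u u
      ≤ ∑ i, operatorA Vh Qh γ (z i + w i) (z i + w i) :=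
        schwarz_le_of_splitting (V := Vh) (operatorA_symm γ) (hstab.operatorA_pos hβ hγ) hW
          (fun i => add_mem (hz i).2 (hw i)) hsplit
    _ ≤ ∑ i, (2 * norm1 (z i : H1 Ω) ^ 2 + 2 * ((1 + γ * d) * norm1 (w i : H1 Ω) ^ 2)) := by
        refine Finset.sum_le_sum fun i _ => (operatorA_add_self_le hγ _ _).trans ?_
        have h1 := operatorA_self_le_of_mem_discreteKernel γ (hz i).1
        have h2 := operatorA_self_le (Qh := Qh) hγ (w i)
        linarith
    _ = 2 * ∑ i, norm1 (z i : H1 Ω) ^ 2 +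
          2 * (1 + γ * d) * ∑ i, norm1 (w i : H1 Ω) ^ 2 := by
        rw [Finset.sum_add_distrib, Finset.mul_sum, Finset.mul_sum]
        simp only [mul_assoc]
    _ ≤ 2 * (c₂ * ((4 * d + 2) * aForm (u : H1 Ω) u / β ^ 2) + δ) +
          2 * (1 + γ * d) * (c₁ * (cForm Qh (u : H1 Ω) u / β ^ 2) + δ) := by
        gcongr
        · exact hzn.trans (by gcongr)
        · exact hwn.trans (by gcongr)
    _ ≤ _ := by
        rw [hA, ← hδε]
        exact splitting_bound (Nat.cast_nonneg d) hγ hc₁ hc₂ hβ2 ha hcn hc δ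

/-- If `Q_h = ∇ · V_h`, the projection in `c_h` acts as the identity on divergences, so that the
energy is the integral of a local density. -/
theorem cForm_self_of_exact (h : Qh = Vh.map div) (u : Vh) :
    cForm Qh (u : H1 Ω) u = ‖div (u : H1 Ω)‖ ^ 2 := by
  have hmem : div (u : H1 Ω) ∈ Qh := h ▸ Submodule.mem_map_of_mem u.2
  have heq : discreteDiv Qh (u : H1 Ω) = div (u : H1 Ω) :=
    Submodule.starProjection_eq_self_iff.2 hmem
  rw [cForm_self, heq]

theorem operatorA_sum_le_of_overlapLE (hΩ : IsOpen Ω) (hex : Qh = Vh.map div)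
    {W : ι → Submodule ℝ Vh} {N : ℕ} (hN : OverlapLE W N) {γ : ℝ} (hγ : 0 ≤ γ) {w : ι → Vh}
    (hw : ∀ i, w i ∈ W i) :
    operatorA Vh Qh γ (∑ i, w i) (∑ i, w i) ≤ N * ∑ i, operatorA Vh Qh γ (w i) (w i) := by
  have hA : ∀ u : Vh, operatorA Vh Qh γ u u =
      ∑ k, ∑ l, ‖symGrad k l (u : H1 Ω)‖ ^ 2 + γ * ‖div (u : H1 Ω)‖ ^ 2 := fun u => by
    rw [operatorA_self, cForm_self_of_exact hex, aForm_self]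
  have hε : ∑ k, ∑ l, ‖symGrad k l ((∑ i, w i : Vh) : H1 Ω)‖ ^ 2 ≤
      N * ∑ i, ∑ k, ∑ l, ‖symGrad k l (w i : H1 Ω)‖ ^ 2 := by
    calc _ ≤ ∑ k, ∑ l, N * ∑ i, ‖symGrad k l (w i : H1 Ω)‖ ^ 2 :=
          Finset.sum_le_sum fun k _ => Finset.sum_le_sum fun l _ =>
            norm_map_sum_sq_le_of_overlapLE hN (symGrad k l)
              (fun v => ae_symGrad_eq_zero_of_notMem_fieldSupport hΩ v k l) hw
      _ = _ := by
          simp only [← Finset.mul_sum]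
          exact congrArg _ ((Finset.sum_congr rfl fun k _ => Finset.sum_comm).trans
            Finset.sum_comm)
  have hdiv := norm_map_sum_sq_le_of_overlapLE hN div
    (ae_div_eq_zero_of_notMem_fieldSupport hΩ) hw
  simp only [hA]
  rw [Finset.sum_add_distrib, mul_add, ← Finset.mul_sum, mul_left_comm]
  exact add_le_add hε (mul_le_mul_of_nonneg_left hdiv hγ)

end Bounds

end Elasticity

open Elasticity
theorem mainTheorem5 (d : ℕ) (β : ℝ) (hβ : 0 < β) :
    ∃ C : ℝ, 0 < C ∧
      ∀ (Ω : Set (EuclideanSpace ℝ (Fin d))), IsOpen Ω →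
      ∀ (Vh : Submodule ℝ (Elasticity.H1 Ω)) [FiniteDimensional ℝ Vh]
        (Qh : Submodule ℝ (Elasticity.L2 Ω)) [FiniteDimensional ℝ Qh],
      Elasticity.InfSupStable Vh Qh β →
      ∀ (ι : Type*) [Fintype ι] (W : ι → Submodule ℝ Vh) (N : ℕ) (c₁ c₂ : ℝ),
      (⨆ i, W i) = ⊤ →
      Elasticity.OverlapLE W N →
      0 < c₁ → 0 ≤ c₂ →
      (∀ u : Vh, Elasticity.splittingEnergy W u
        ≤ ENNReal.ofReal (c₁ * Elasticity.norm0 (u : Elasticity.H1 Ω) ^ 2)) →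
      (∀ u ∈ Elasticity.discreteKernel Vh Qh,
        Elasticity.splittingEnergy (fun i => Elasticity.discreteKernel Vh Qh ⊓ W i) u
          ≤ ENNReal.ofReal (c₂ * Elasticity.norm0 (u : Elasticity.H1 Ω) ^ 2)) →
      ∀ γ : ℝ, 0 ≤ γ →
        -- the operators that are inverted in the definition of the preconditioner are invertible
        (∀ i, Function.Bijective
          (Elasticity.localOperator (Elasticity.operatorA Vh Qh γ) (W i))) ∧
        Function.Bijective (Elasticity.schwarzInverse (Elasticity.operatorA Vh Qh γ) W) ∧
        -- the lower spectral bound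
        (∀ u : Vh, (c₁ + c₂)⁻¹ * Elasticity.schwarz (Elasticity.operatorA Vh Qh γ) W u u
          ≤ C * Elasticity.operatorA Vh Qh γ u u) ∧
        -- the upper spectral bound, for exact pairs
        (Qh = Vh.map Elasticity.div →
          ∀ u : Vh, Elasticity.operatorA Vh Qh γ u u
            ≤ N * Elasticity.schwarz (Elasticity.operatorA Vh Qh γ) W u u) := by
  refine ⟨(8 * d + 4) / β ^ 2, by positivity, ?_⟩
  intro Ω hΩ Vh _ Qh _ hstab ι _ W N c₁ c₂ hW hN hc₁ hc₂ h₁ h₂ γ hγ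
  have hpos := hstab.operatorA_pos hβ hγ
  refine ⟨fun i => localOperator_bijective (V := Vh) hpos (W i),
    schwarzInverse_bijective (V := Vh) hpos hW, fun u => ?_, fun hex u => ?_⟩
  · rw [inv_mul_le_iff₀ (by positivity)]
    exact schwarz_operatorA_le hβ hstab hW hc₁.le hc₂ h₁ h₂ hγ u
  · obtain ⟨w, hw, hwu, hD⟩ := exists_splitting_schwarz_eq (V := Vh) hpos hW u
    rw [hD]
    conv_lhs => rw [← hwu]
    exact operatorA_sum_le_of_overlapLE hΩ hex hN hγ hw
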